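/- Let $a, b, c$ be integers with $1 < a \le b \le c$. Then there exist elements $x, y, z$ of the symmetric group $S_{c+2}$ of orders $|x| = a$, $|y| = b$, $|z| = c$ with $xyz = 1$. Moreover, $x, y, z$ can be chosen such that, in addition, all of the following hold: 1. $z$ is a $c$-cycle or the disjoint product of a $c$-cycle and a transposition; 2. in its disjoint cycle decomposition, $x$ has only cycles of length $a$ and (possibly) fixed points, with the exception of at most one transposition; 3. in its disjoint cycle decomposition, $y$ has only cycles of length $b$ and (possibly) fixed points, with the exception of at most one transposition; 4. the exceptional transposition occurs in at most one of $x$, $y$ and $z$. Here, if $a = 2$ (resp. $b = 2$), the $2$-cycles of $x$ (resp. $y$) are cycles of length $a$ (resp. $b$) and are not counted as exceptional. -/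

import Mathlib

namespace CycleTriple

open Equiv Equiv.Perm

/-! ### Cycle lengths, transversals and full cycles -/

variable {α : Type*}

/-! Let `x * y` be a full cycle on `n` points. Then `x` and `y` together have `n + 1 - 2 * g`
cycles, where `g ≥ 0` is a genus. Conversely, `realizable` produces `x` and `y` for all cycle
lengths with such a count, even with a point `t` common to a chosen cycle of each. Genus zero means
a bicoloured plane tree, whose vertices are the cycles of `x` and `y` and whose edges are the
points; it is grown leaf by leaf. The genus rises by one when two fixed points of `y` are absorbed
into another cycle: the first transposition splits the full cycle, and the second can be chosen to
rejoin it (`IsFullCycle.mul_swap_mul_swap`).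

For the theorem, `x` and `y` get as many cycles of lengths `a` and `b` as fit into `c` points. If
the parity of the count is wrong, it is corrected at `t` by one or two new points, which add a
transposition to `x`, to `y` or, for even `c`, to the product. If `a = 2` divides `c`, a 2-cycle of
`x` is dropped instead, except for `c = 2`. -/

theorem sameCycle_map {β : Type*} {σ : Perm α} {τ : Perm β} (f : α → β)
    (h : ∀ a, SameCycle τ (f a) (f (σ a))) {a b : α} (hab : SameCycle σ a b) :
    SameCycle τ (f a) (f b) := by
  obtain ⟨n, rfl⟩ := hab
  induction n using Int.induction_on with
  | zero => exact SameCycle.refl _ _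
  | succ n ih =>
    rw [add_comm, zpow_one_add, mul_apply]
    exact ih.trans (h _)
  | pred n ih =>
    have h1 := h ((σ ^ (-(n : ℤ) - 1)) a)
    rw [← mul_apply, ← zpow_one_add] at h1
    rw [show (1 : ℤ) + (-(n : ℤ) - 1) = -n by ring] at h1
    exact ih.trans h1.symm

theorem eq_of_sameCycle_of_fixed {σ : Perm α} {u v : α} (hv : σ v = v)
    (h : SameCycle σ u v) : u = v := by
  obtain ⟨n, hn⟩ := h.symm
  rw [zpow_apply_eq_self_of_apply_eq_self hv] at hn
  exact hn.symm

/-- The number of points in the cycle of `σ` through `u`. -/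
noncomputable def cycleLength (σ : Perm α) (u : α) : ℕ := {w | SameCycle σ u w}.ncard

theorem cycleLength_congr {σ : Perm α} {u v : α} (h : SameCycle σ u v) :
    cycleLength σ u = cycleLength σ v := by
  unfold cycleLength
  congr 1
  ext w
  exact ⟨fun h' => h.symm.trans h', fun h' => h.trans h'⟩

theorem cycleLength_inv (σ : Perm α) (u : α) : cycleLength σ⁻¹ u = cycleLength σ u := by
  simp [cycleLength, sameCycle_inv]

theorem cycleLength_eq_one_of_fixed {σ : Perm α} {u : α} (h : σ u = u) :
    cycleLength σ u = 1 := by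
  unfold cycleLength
  rw [Set.ncard_eq_one]
  refine ⟨u, Set.ext fun w => ⟨fun hw => eq_of_sameCycle_of_fixed h (SameCycle.symm hw), ?_⟩⟩
  rintro rfl
  exact SameCycle.refl _ _

theorem fixed_of_cycleLength_eq_one {σ : Perm α} {u : α} (h : cycleLength σ u = 1) :
    σ u = u := by
  obtain ⟨w, hw⟩ := Set.ncard_eq_one.1 h
  have h1 : u ∈ ({w} : Set α) := hw ▸ SameCycle.refl σ u
  have h2 : σ u ∈ ({w} : Set α) := hw ▸ (sameCycle_apply_right.2 (SameCycle.refl σ u))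
  rw [Set.mem_singleton_iff] at h1 h2
  rw [h2, ← h1]

/-- `R` contains exactly one point of every cycle of `σ` on `s`, and `σ` fixes the points
outside `s`. -/
structure IsTransversal (σ : Perm α) (s R : Finset α) : Prop where
  fixed : ∀ u, u ∉ s → σ u = u
  subset : R ⊆ s
  inj : ∀ u ∈ R, ∀ w ∈ R, SameCycle σ u w → u = w
  cover : ∀ u ∈ s, ∃ r ∈ R, SameCycle σ r u

theorem IsTransversal.inv {σ : Perm α} {s R : Finset α} (h : IsTransversal σ s R) :
    IsTransversal σ⁻¹ s R where
  fixed u hu := by rw [inv_eq_iff_eq, h.fixed u hu]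
  subset := h.subset
  inj u hu w hw huw := h.inj u hu w hw (sameCycle_inv.1 huw)
  cover u hu := by
    obtain ⟨r, hr, hru⟩ := h.cover u hu
    exact ⟨r, hr, sameCycle_inv.2 hru⟩

/-- `w` permutes the points of `s` in one cycle and fixes all other points. -/
structure IsFullCycle (w : Perm α) (s : Finset α) : Prop where
  fixed : ∀ u, u ∉ s → w u = u
  same : ∀ u ∈ s, ∀ v ∈ s, SameCycle w u v

theorem IsFullCycle.inv {w : Perm α} {s : Finset α} (h : IsFullCycle w s) :
    IsFullCycle w⁻¹ s :=
  ⟨fun u hu => by rw [inv_eq_iff_eq, h.fixed u hu],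
    fun u hu v hv => sameCycle_inv.2 (h.same u hu v hv)⟩

/-! ### Multiplication by a transposition -/

variable [DecidableEq α]

theorem sameCycle_mul_swap_of_sameCycle {σ : Perm α} {i v : α} (hv : σ v = v) {a b : α}
    (h : SameCycle σ a b) : SameCycle (σ * swap i v) a b := by
  refine sameCycle_map id (fun a => ?_) h
  by_cases ha : a = v
  · subst ha; simp only [id, hv]; exact SameCycle.refl _ _
  by_cases hi : a = i
  · subst hi
    -- The new cycle makes a detour: `i` goes to `v`, and `v` to `σ i`.
    refine ⟨2, ?_⟩
    simp [zpow_ofNat, pow_two, hv]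
  · exact ⟨1, by simp [swap_apply_of_ne_of_ne hi ha]⟩

theorem sameCycle_mul_swap_self {σ : Perm α} {i v : α} (hv : σ v = v) :
    SameCycle (σ * swap i v) i v := ⟨1, by simp [hv]⟩

/-- As `v` is inserted right after `i`, collapsing `v` onto `i` takes the new cycles to the old
ones. -/
theorem sameCycle_mul_swap_iff {σ : Perm α} {i v : α} (hv : σ v = v) (hiv : i ≠ v) {a b : α} :
    SameCycle (σ * swap i v) a b ↔
      SameCycle σ (if a = v then i else a) (if b = v then i else b) := by
  constructor
  · refine sameCycle_map (fun u => if u = v then i else u) (fun a => ?_)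
    have hne : ∀ u, u ≠ v → σ u ≠ v := fun u hu h => hu (σ.injective (h.trans hv.symm))
    by_cases ha : a = v
    · subst ha
      simp only [mul_apply, swap_apply_right, if_true, if_neg (hne i hiv)]
      exact ⟨1, by simp⟩
    by_cases hi : a = i
    · subst hi
      simp only [mul_apply, swap_apply_left, hv, if_true, ite_self]
      simp [SameCycle.refl]
    · simp only [mul_apply, swap_apply_of_ne_of_ne hi ha, if_neg ha, if_neg (hne a ha)]
      exact ⟨1, by simp⟩
  · intro h
    have key : ∀ u, SameCycle (σ * swap i v) u (if u = v then i else u) := by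
      intro u
      split_ifs with hu
      · subst hu; exact (sameCycle_mul_swap_self hv).symm
      · exact SameCycle.refl _ _
    exact (key a).trans ((sameCycle_mul_swap_of_sameCycle hv h).trans (key b).symm)

theorem IsTransversal.insert {σ : Perm α} {s R : Finset α} (h : IsTransversal σ s R) {v : α}
    (hv : v ∉ s) : IsTransversal σ (insert v s) (insert v R) where
  fixed u hu := h.fixed u fun h' => hu (Finset.mem_insert_of_mem h')
  subset := Finset.insert_subset_insert _ h.subset
  inj u hu w hw huw := by
    have hvf := h.fixed v hv
    rcases Finset.mem_insert.1 hu with rfl | hu'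
    · exact (eq_of_sameCycle_of_fixed hvf huw.symm).symm
    · rcases Finset.mem_insert.1 hw with rfl | hw'
      · exact eq_of_sameCycle_of_fixed hvf huw
      · exact h.inj u hu' w hw' huw
  cover u hu := by
    rcases Finset.mem_insert.1 hu with rfl | hu'
    · exact ⟨u, Finset.mem_insert_self _ _, SameCycle.refl _ _⟩
    · obtain ⟨r, hr, hru⟩ := h.cover u hu'
      exact ⟨r, Finset.mem_insert_of_mem hr, hru⟩

theorem IsTransversal.replace {σ : Perm α} {s R : Finset α} {t t' : α} (htR : t ∉ R)
    (h : IsTransversal σ s (Insert.insert t R)) (htt' : SameCycle σ t t') (ht' : t' ∈ s) :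
    t' ∉ R ∧ IsTransversal σ s (Insert.insert t' R) := by
  have hn : ∀ w ∈ R, ¬ SameCycle σ t w := fun w hw hc => by
    have := h.inj t (Finset.mem_insert_self _ _) w (Finset.mem_insert_of_mem hw) hc
    exact htR (this ▸ hw)
  refine ⟨fun h' => hn t' h' htt', h.fixed, ?_, ?_, ?_⟩
  · exact Finset.insert_subset ht' ((Finset.subset_insert _ _).trans h.subset)
  · intro u hu w hw huw
    rcases Finset.mem_insert.1 hu with rfl | hu'
    · rcases Finset.mem_insert.1 hw with rfl | hw'
      · rfl
      · exact (hn w hw' (htt'.trans huw)).elim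
    · rcases Finset.mem_insert.1 hw with rfl | hw'
      · exact (hn u hu' (htt'.trans huw.symm)).elim
      · exact h.inj u (Finset.mem_insert_of_mem hu') w (Finset.mem_insert_of_mem hw') huw
  · intro u hu
    obtain ⟨r, hr, hru⟩ := h.cover u hu
    rcases Finset.mem_insert.1 hr with rfl | hr'
    · exact ⟨t', Finset.mem_insert_self _ _, htt'.symm.trans hru⟩
    · exact ⟨r, Finset.mem_insert_of_mem hr', hru⟩

/-- The place of insertion `i` is kept apart from the representative `r`, since `exists_absorb_two`
needs a choice of place. -/
theorem IsTransversal.absorb [Finite α] {σ : Perm α} {s R : Finset α} (h : IsTransversal σ s R)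
    {r i v : α} (hr : r ∈ R) (hri : SameCycle σ r i) (hv : v ∈ R) (hvf : σ v = v) (hvr : v ≠ r) :
    IsTransversal (σ * swap i v) s (R.erase v) ∧
      cycleLength (σ * swap i v) r = cycleLength σ r + 1 ∧
      ∀ u ∈ R, u ≠ r → u ≠ v → cycleLength (σ * swap i v) u = cycleLength σ u := by
  have hiv : i ≠ v := fun e => hvr (eq_of_sameCycle_of_fixed hvf (e ▸ hri)).symm
  have his : i ∈ s := by
    by_contra hi
    have := eq_of_sameCycle_of_fixed (h.fixed i hi) hri
    exact hi (this ▸ h.subset hr)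
  refine ⟨⟨?_, ?_, ?_, ?_⟩, ?_, ?_⟩
  · intro u hu
    have h1 : u ≠ i := fun e => hu (e ▸ his)
    have h2 : u ≠ v := fun e => hu (e ▸ h.subset hv)
    rw [mul_apply, swap_apply_of_ne_of_ne h1 h2, h.fixed u hu]
  · exact (Finset.erase_subset _ _).trans h.subset
  · intro u hu w hw huw
    rw [Finset.mem_erase] at hu hw
    rw [sameCycle_mul_swap_iff hvf hiv, if_neg hu.1, if_neg hw.1] at huw
    exact h.inj u hu.2 w hw.2 huw
  · intro u hu
    obtain ⟨w, hw, hwu⟩ := h.cover u hu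
    by_cases hwv : w = v
    · subst hwv
      refine ⟨r, Finset.mem_erase.2 ⟨hvr.symm, hr⟩, ?_⟩
      exact (sameCycle_mul_swap_of_sameCycle hvf hri).trans
        ((sameCycle_mul_swap_self hvf).trans (sameCycle_mul_swap_of_sameCycle hvf hwu))
    · exact ⟨w, Finset.mem_erase.2 ⟨hwv, hw⟩, sameCycle_mul_swap_of_sameCycle hvf hwu⟩
  · have : {w | SameCycle (σ * swap i v) r w} = Insert.insert v {w | SameCycle σ r w} := by
      ext w
      simp only [Set.mem_ofPred_eq, Set.mem_insert_iff]
      rw [sameCycle_mul_swap_iff hvf hiv, if_neg hvr.symm]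
      split_ifs with hw
      · simp [hw, hri]
      · simp [hw]
    rw [cycleLength, this, Set.ncard_insert_of_notMem, cycleLength]
    exact fun hc => hvr (eq_of_sameCycle_of_fixed hvf hc).symm
  · intro u hu hur huv
    unfold cycleLength
    congr 1
    ext w
    simp only [Set.mem_ofPred_eq]
    rw [sameCycle_mul_swap_iff hvf hiv, if_neg huv]
    split_ifs with hw
    · subst hw
      constructor
      · exact fun hc => (hur (h.inj u hu r hr (hc.trans hri.symm))).elim
      · exact fun hc => (huv (h.inj u hu _ hv hc)).elim
    · rfl

theorem IsFullCycle.insert {w : Perm α} {s : Finset α} (h : IsFullCycle w s) {i v : α}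
    (hi : i ∈ s) (hv : v ∉ s) : IsFullCycle (w * swap i v) (insert v s) := by
  have hvf := h.fixed v hv
  refine ⟨fun u hu => ?_, ?_⟩
  · rw [Finset.mem_insert, not_or] at hu
    rw [mul_apply, swap_apply_of_ne_of_ne (by rintro rfl; exact hu.2 hi) hu.1, h.fixed u hu.2]
  · have key : ∀ u ∈ Insert.insert v s, SameCycle (w * swap i v) i u := by
      intro u hu
      rcases Finset.mem_insert.1 hu with rfl | hu
      · exact sameCycle_mul_swap_self hvf
      · exact sameCycle_mul_swap_of_sameCycle hvf (h.same i hi u hu)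
    exact fun u hu u' hu' => (key u hu).symm.trans (key u' hu')

/-- From `i` the new permutation goes to `w k` and then along the `w`-cycle of `k`, which avoids
`i`, back to `k`. -/
theorem sameCycle_mul_swap_of_not_sameCycle [Finite α] {w : Perm α} {i k : α}
    (h : ¬ SameCycle w i k) : SameCycle (w * swap i k) i k := by
  by_contra hc
  have key : ∀ m : ℕ, SameCycle (w * swap i k) i ((w ^ (m + 1)) k) := by
    intro m
    induction m with
    | zero => exact ⟨1, by simp⟩
    | succ m ih =>
      set u := (w ^ (m + 1)) k with hu
      have hui : u ≠ i := fun e => h (SameCycle.symm ⟨(m + 1 : ℕ), by rw [zpow_natCast, ← hu, e]⟩)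
      have huk : u ≠ k := fun e => hc (e ▸ ih)
      refine ih.trans ⟨1, ?_⟩
      rw [pow_succ', mul_apply, ← hu]
      simp [swap_apply_of_ne_of_ne hui huk]
  obtain ⟨m, hm, hk⟩ := (isOfFinOrder_of_finite w).exists_pow_eq_one
  have := key (m - 1)
  rw [Nat.sub_add_cancel hm, hk] at this
  exact hc this

theorem sameCycle_mul_swap_mono {w : Perm α} {i k : α} (h : SameCycle (w * swap i k) i k)
    {a b : α} (hab : SameCycle w a b) : SameCycle (w * swap i k) a b := by
  refine sameCycle_map id (fun a => ?_) hab
  by_cases hi : a = i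
  · subst hi; exact h.trans ⟨1, by simp⟩
  by_cases hk : a = k
  · subst hk; exact h.symm.trans ⟨1, by simp⟩
  · exact ⟨1, by simp [swap_apply_of_ne_of_ne hi hk]⟩

theorem sameCycle_or_of_mul_swap [Finite α] {w : Perm α} {i j : α} {u : α}
    (h : SameCycle w i u) :
    SameCycle (w * swap i j) i u ∨ SameCycle (w * swap i j) j u := by
  obtain ⟨n, rfl⟩ := h.exists_nat_pow_eq
  clear h
  induction n with
  | zero => exact Or.inl (SameCycle.refl _ _)
  | succ n ih =>
    rw [pow_succ', mul_apply]
    set u := (w ^ n) i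
    by_cases hi : u = i
    · rw [hi]; exact Or.inr ⟨1, by simp⟩
    by_cases hj : u = j
    · rw [hj]; exact Or.inl ⟨1, by simp⟩
    · have : SameCycle (w * swap i j) u (w u) := ⟨1, by simp [swap_apply_of_ne_of_ne hi hj]⟩
      exact ih.imp (fun h => h.trans this) (fun h => h.trans this)

theorem IsFullCycle.isCycle [Fintype α] {w : Perm α} {s : Finset α} (h : IsFullCycle w s)
    (hs : 1 < s.card) : IsCycle w ∧ w.support = s := by
  have hne : ∀ u ∈ s, w u ≠ u := by
    intro u hu hf
    obtain ⟨v, hv, hvu⟩ := Finset.exists_mem_ne hs u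
    exact hvu (eq_of_sameCycle_of_fixed hf (h.same v hv u hu))
  have hsub : ∀ u, w u ≠ u → u ∈ s := fun u hu => by
    by_contra hc; exact hu (h.fixed u hc)
  refine ⟨?_, ?_⟩
  · obtain ⟨i, hi⟩ := Finset.card_pos.1 (by omega : 0 < s.card)
    exact ⟨i, hne i hi, fun y hy => h.same i hi y (hsub y hy)⟩
  · ext u
    rw [mem_support]
    exact ⟨hsub u, hne u⟩

/-- Otherwise both permutations would be cycles with support `s`, hence of equal sign, but a
transposition changes the sign. -/
theorem IsFullCycle.not_sameCycle_mul_swap [Fintype α] {w : Perm α} {s : Finset α}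
    (h : IsFullCycle w s) {i j : α} (hi : i ∈ s) (hj : j ∈ s) (hij : i ≠ j) :
    ¬ SameCycle (w * swap i j) i j := by
  intro hc
  have hs : 1 < s.card := Finset.one_lt_card.2 ⟨i, hi, j, hj, hij⟩
  have h' : IsFullCycle (w * swap i j) s := by
    refine ⟨fun u hu => ?_, fun u hu v hv => sameCycle_mul_swap_mono hc (h.same u hu v hv)⟩
    rw [mul_apply, swap_apply_of_ne_of_ne (by rintro rfl; exact hu hi) (by rintro rfl; exact hu hj),
      h.fixed u hu]
  have e1 := (h.isCycle hs).1.sign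
  have e2 := (h'.isCycle hs).1.sign
  rw [(h.isCycle hs).2] at e1
  rw [(h'.isCycle hs).2, Perm.sign_mul, sign_swap hij, e1] at e2
  have := congrArg (fun z : ℤˣ => (z : ℤ)) e2
  rcases neg_one_pow_eq_or ℤ s.card with h1 | h1 <;> simp [h1] at this

theorem IsFullCycle.mul_swap_mul_swap [Fintype α] {w : Perm α} {s : Finset α}
    (h : IsFullCycle w s) {i j k : α} (hi : i ∈ s) (hj : j ∈ s) (hk : k ∈ s) (hij : i ≠ j) :
    IsFullCycle (w * swap i j * swap i k) s ∨ IsFullCycle (w * swap i j * swap j k) s := by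
  have hn := h.not_sameCycle_mul_swap hi hj hij
  have hor : ∀ u ∈ s, SameCycle (w * swap i j) i u ∨ SameCycle (w * swap i j) j u :=
    fun u hu => sameCycle_or_of_mul_swap (h.same i hi u hu)
  have hfix : ∀ a ∈ s, ∀ u, u ∉ s → (w * swap i j * swap a k) u = u := by
    intro a ha u hu
    have hne : ∀ b ∈ s, u ≠ b := fun b hb e => hu (e ▸ hb)
    rw [mul_apply, swap_apply_of_ne_of_ne (hne a ha) (hne k hk), mul_apply,
      swap_apply_of_ne_of_ne (hne i hi) (hne j hj), h.fixed u hu]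
  -- `k` lies in one of the two pieces; the second transposition pairs it with `i` or `j`, whichever
  -- is in the other.
  rcases hor k hk with hik | hjk
  · right
    refine ⟨hfix j hj, ?_⟩
    have hm := sameCycle_mul_swap_of_not_sameCycle (fun hc => hn (hik.trans hc.symm) : ¬
      SameCycle (w * swap i j) j k)
    have key : ∀ u ∈ s, SameCycle (w * swap i j * swap j k) k u := by
      intro u hu
      rcases hor u hu with h1 | h1
      · exact sameCycle_mul_swap_mono hm (hik.symm.trans h1)
      · exact hm.symm.trans (sameCycle_mul_swap_mono hm h1)
    exact fun u hu v hv => (key u hu).symm.trans (key v hv)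
  · left
    refine ⟨hfix i hi, ?_⟩
    have hm := sameCycle_mul_swap_of_not_sameCycle (fun hc => hn (hc.trans hjk.symm) : ¬
      SameCycle (w * swap i j) i k)
    have key : ∀ u ∈ s, SameCycle (w * swap i j * swap i k) k u := by
      intro u hu
      rcases hor u hu with h1 | h1
      · exact hm.symm.trans (sameCycle_mul_swap_mono hm h1)
      · exact sameCycle_mul_swap_mono hm (hjk.symm.trans h1)
    exact fun u hu v hv => (key u hu).symm.trans (key v hv)

/-- Two fixed points of `y` can be joined to any other cycle of `y` such that `x * y` remains a
full cycle. -/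
theorem exists_absorb_two [Fintype α] {x y : Perm α} {s R : Finset α}
    (hw : IsFullCycle (x * y) s) (h : IsTransversal y s R) {r j k : α} (hr : r ∈ R) (hj : j ∈ R)
    (hk : k ∈ R) (hjf : y j = j) (hkf : y k = k) (hjr : j ≠ r) (hkr : k ≠ r) (hjk : j ≠ k) :
    ∃ y' : Perm α, IsFullCycle (x * y') s ∧ IsTransversal y' s ((R.erase j).erase k) ∧
      cycleLength y' r = cycleLength y r + 2 ∧
      ∀ u ∈ R, u ≠ r → u ≠ j → u ≠ k → cycleLength y' u = cycleLength y u := by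
  obtain ⟨h1, l1, e1⟩ := h.absorb hr (SameCycle.refl y r) hj hjf hjr
  have hk' : k ∈ R.erase j := Finset.mem_erase.2 ⟨hjk.symm, hk⟩
  have hr' : r ∈ R.erase j := Finset.mem_erase.2 ⟨hjr.symm, hr⟩
  have hkf' : (y * swap r j) k = k := by
    rw [mul_apply, swap_apply_of_ne_of_ne hkr hjk.symm, hkf]
  -- `r` and `j` now share a cycle, so either choice of the second transposition adds `k` to it.
  have fin : ∀ a, SameCycle (y * swap r j) r a →
      IsTransversal (y * swap r j * swap a k) s ((R.erase j).erase k) ∧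
      cycleLength (y * swap r j * swap a k) r = cycleLength y r + 2 ∧
      ∀ u ∈ R, u ≠ r → u ≠ j → u ≠ k →
        cycleLength (y * swap r j * swap a k) u = cycleLength y u := by
    intro a ha
    obtain ⟨h2, l2, e2⟩ := h1.absorb hr' ha hk' hkf' hkr
    refine ⟨h2, by rw [l2, l1], fun u hu hur huj huk => ?_⟩
    rw [e2 u (Finset.mem_erase.2 ⟨huj, hu⟩) hur huk, e1 u hu hur huj]
  rcases hw.mul_swap_mul_swap (h.subset hr) (h.subset hj) (h.subset hk) hjr.symm with hc | hc
  · exact ⟨_, by simpa only [mul_assoc] using hc, fin r (SameCycle.refl _ _)⟩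
  · exact ⟨_, by simpa only [mul_assoc] using hc, fin j (sameCycle_mul_swap_self hjf)⟩

/-! ### Cycle types and marked cycles -/

theorem IsTransversal.cycleType_eq [Fintype α] {σ : Perm α} {s R : Finset α}
    (h : IsTransversal σ s R) :
    σ.cycleType = (R.val.map (cycleLength σ)).filter (1 < ·) := by
  have hlen : ∀ u, σ u ≠ u → cycleLength σ u = (σ.cycleOf u).support.card := by
    intro u hu
    unfold cycleLength
    rw [← Set.ncard_coe_finset]
    congr 1
    ext w
    simp [mem_support_cycleOf_iff' hu]
  have hpos : ∀ u, 1 < cycleLength σ u ↔ σ u ≠ u := by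
    intro u
    constructor
    · intro h1 h2
      rw [cycleLength_eq_one_of_fixed h2] at h1
      omega
    · intro h1
      rw [hlen u h1]
      exact (isCycle_cycleOf σ h1).two_le_card_support
  have hfac : σ.cycleFactorsFinset = (R.filter (fun u => σ u ≠ u)).image (σ.cycleOf) := by
    ext f
    simp only [Finset.mem_image, Finset.mem_filter]
    constructor
    · intro hf
      obtain ⟨u, hu⟩ := (mem_cycleFactorsFinset_iff.1 hf).1.nonempty_support
      have hfu : f = σ.cycleOf u := cycle_is_cycleOf hu hf
      have hσu : σ u ≠ u := by
        have := mem_cycleFactorsFinset_support_le hf hu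
        exact mem_support.1 this
      have hus : u ∈ s := by by_contra hc; exact hσu (h.fixed u hc)
      obtain ⟨r, hr, hru⟩ := h.cover u hus
      refine ⟨r, ⟨hr, fun hc => ?_⟩, ?_⟩
      · have := eq_of_sameCycle_of_fixed hc hru.symm
        exact hσu (this ▸ hc)
      · rw [hfu]; exact hru.cycleOf_eq
    · rintro ⟨r, ⟨-, hr⟩, rfl⟩
      exact cycleOf_mem_cycleFactorsFinset_iff.2 (mem_support.2 hr)
  have hinj : Set.InjOn σ.cycleOf (R.filter (fun u => σ u ≠ u) : Finset α) := by
    intro u hu w hw huw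
    simp only [Finset.coe_filter, Set.mem_ofPred_eq] at hu hw
    refine h.inj u hu.1 w hw.1 ?_
    have : w ∈ (σ.cycleOf u).support := by
      change σ.cycleOf u = σ.cycleOf w at huw
      rw [huw, mem_support_cycleOf_iff' hw.2]
    exact (mem_support_cycleOf_iff' hu.2).1 this
  rw [cycleType_def, hfac, Finset.image_val_of_injOn hinj, Multiset.map_map, Multiset.filter_map,
    Finset.filter_val]
  have : Multiset.filter ((fun x => 1 < x) ∘ cycleLength σ) R.val =
      Multiset.filter (fun u => σ u ≠ u) R.val :=
    Multiset.filter_congr fun u _ => hpos u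
  rw [this]
  refine Multiset.map_congr rfl fun u hu => ?_
  rw [hlen u (Multiset.mem_filter.1 hu).2]
  rfl

/-- The cycles of `σ` on `s` are one of length `p`, through `t`, and others with lengths `A`. -/
def HasCycles (σ : Perm α) (s : Finset α) (t : α) (p : ℕ) (A : Multiset ℕ) : Prop :=
  ∃ R : Finset α, t ∉ R ∧ IsTransversal σ s (insert t R) ∧ cycleLength σ t = p ∧
    R.val.map (cycleLength σ) = A

theorem HasCycles.mem {σ : Perm α} {s : Finset α} {t : α} {p : ℕ} {A : Multiset ℕ}
    (h : HasCycles σ s t p A) : t ∈ s := by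
  obtain ⟨R, -, h1, -⟩ := h
  exact h1.subset (Finset.mem_insert_self _ _)

theorem HasCycles.fixed {σ : Perm α} {s : Finset α} {t : α} {p : ℕ} {A : Multiset ℕ}
    (h : HasCycles σ s t p A) {u : α} (hu : u ∉ s) : σ u = u := by
  obtain ⟨R, -, h1, -⟩ := h
  exact h1.fixed u hu

theorem HasCycles.inv {σ : Perm α} {s : Finset α} {t : α} {p : ℕ} {A : Multiset ℕ}
    (h : HasCycles σ s t p A) : HasCycles σ⁻¹ s t p A := by
  obtain ⟨R, h1, h2, h3, h4⟩ := h
  refine ⟨R, h1, h2.inv, by rw [cycleLength_inv, h3], ?_⟩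
  rw [← h4]
  exact Multiset.map_congr rfl fun u _ => cycleLength_inv σ u

theorem HasCycles.insert {σ : Perm α} {s : Finset α} {t : α} {p : ℕ} {A : Multiset ℕ}
    (h : HasCycles σ s t p A) {v : α} (hv : v ∉ s) :
    HasCycles σ (insert v s) t p (1 ::ₘ A) := by
  have ht := h.mem
  have hvf := h.fixed hv
  obtain ⟨R, h1, h2, h3, h4⟩ := h
  have hvR : v ∉ R := fun hc => hv (h2.subset (Finset.mem_insert_of_mem hc))
  refine ⟨Insert.insert v R, ?_, ?_, h3, ?_⟩
  · rw [Finset.mem_insert, not_or]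
    exact ⟨fun e => hv (e ▸ ht), h1⟩
  · rw [Finset.insert_comm]; exact h2.insert hv
  · rw [Finset.insert_val_of_notMem hvR, Multiset.map_cons, h4, cycleLength_eq_one_of_fixed hvf]

theorem HasCycles.insert_self {σ : Perm α} {s : Finset α} {t : α} {p : ℕ} {A : Multiset ℕ}
    (h : HasCycles σ s t p A) {v : α} (hv : v ∉ s) :
    HasCycles σ (Insert.insert v s) v 1 (p ::ₘ A) := by
  have hvf := h.fixed hv
  obtain ⟨R, h1, h2, h3, h4⟩ := h
  refine ⟨Insert.insert t R, fun hc => hv (h2.subset hc), h2.insert hv,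
    cycleLength_eq_one_of_fixed hvf, ?_⟩
  rw [Finset.insert_val_of_notMem h1, Multiset.map_cons, h4, h3]

theorem HasCycles.congr_point {σ : Perm α} {s : Finset α} {t t' : α} {p : ℕ} {A : Multiset ℕ}
    (h : HasCycles σ s t p A) (htt' : SameCycle σ t t') (ht' : t' ∈ s) :
    HasCycles σ s t' p A := by
  obtain ⟨R, h1, h2, h3, h4⟩ := h
  obtain ⟨h5, h6⟩ := IsTransversal.replace h1 h2 htt' ht'
  exact ⟨R, h5, h6, by rw [← cycleLength_congr htt', h3], h4⟩

theorem HasCycles.mul_swap [Finite α] {σ : Perm α} {s : Finset α} {t : α} {p : ℕ}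
    {A : Multiset ℕ} (h : HasCycles σ s t p A) {v : α} (hv : v ∉ s) :
    HasCycles (σ * swap t v) (Insert.insert v s) t (p + 1) A := by
  have ht := h.mem
  have hvf := h.fixed hv
  have hvt : v ≠ t := fun e => hv (e ▸ ht)
  obtain ⟨R, h1, h2, h3, h4⟩ := h
  have hvR : v ∉ Insert.insert t R := fun hc => hv (h2.subset hc)
  obtain ⟨h5, h6, h7⟩ := (h2.insert hv).absorb (r := t) (i := t) (v := v) (by simp)
    (SameCycle.refl _ _) (by simp) hvf hvt
  rw [Finset.erase_insert hvR] at h5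
  refine ⟨R, h1, h5, by rw [h6, h3], ?_⟩
  rw [← h4]
  refine Multiset.map_congr rfl fun u hu => h7 u (by rw [Finset.mem_val] at hu; simp [hu]) ?_ ?_
  · exact fun e => h1 (e ▸ hu)
  · exact fun e => hvR (by rw [← e]; exact Finset.mem_insert_of_mem hu)

theorem HasCycles.cycleType_eq [Fintype α] {σ : Perm α} {s : Finset α} {t : α} {p : ℕ}
    {A : Multiset ℕ} (h : HasCycles σ s t p A) :
    σ.cycleType = (p ::ₘ A).filter (1 < ·) := by
  obtain ⟨R, h1, h2, h3, h4⟩ := h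
  rw [h2.cycleType_eq, Finset.insert_val_of_notMem h1, Multiset.map_cons, h3, h4]

/-- Some `x` and `y` whose product is a full cycle on `s` have cycle lengths `p`, `A` and
`q`, `B` on `s`, where the cycles of lengths `p` and `q` meet. -/
def Realizable (s : Finset α) (p q : ℕ) (A B : Multiset ℕ) : Prop :=
  ∃ (x y : Perm α) (t : α), IsFullCycle (x * y) s ∧ HasCycles x s t p A ∧ HasCycles y s t q B

/-! ### Adding leaves and merging cycles -/

theorem Realizable.symm {s : Finset α} {p q : ℕ} {A B : Multiset ℕ}
    (h : Realizable s p q A B) : Realizable s q p B A := by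
  obtain ⟨x, y, t, hw, hx, hy⟩ := h
  exact ⟨y⁻¹, x⁻¹, t, by rw [← mul_inv_rev]; exact hw.inv, hy.inv, hx.inv⟩

theorem Realizable.insert_leaf [Finite α] {s : Finset α} {p q : ℕ} {A B : Multiset ℕ}
    (h : Realizable s p q A B) {v : α} (hv : v ∉ s) :
    Realizable (insert v s) p (q + 1) (1 ::ₘ A) B := by
  obtain ⟨x, y, t, hw, hx, hy⟩ := h
  refine ⟨x, y * swap t v, t, ?_, hx.insert hv, hy.mul_swap hv⟩
  rw [← mul_assoc]
  exact hw.insert hx.mem hv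

/-- Serves the induction when the leaf removed is itself the marked cycle of `x`. -/
theorem Realizable.insert_leaf_self [Finite α] {s : Finset α} {p q : ℕ} {A B : Multiset ℕ}
    (h : Realizable s p q A B) {v : α} (hv : v ∉ s) :
    Realizable (insert v s) 1 (q + 1) (p ::ₘ A) B := by
  obtain ⟨x, y, t, hw, hx, hy⟩ := h
  refine ⟨x, y * swap t v, v, ?_, hx.insert_self hv, ?_⟩
  · rw [← mul_assoc]
    exact hw.insert hx.mem hv
  · exact (hy.mul_swap hv).congr_point (sameCycle_mul_swap_self (hy.fixed hv))
      (Finset.mem_insert_self _ _)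

theorem map_eq_cons {R : Finset α} {f : α → ℕ} {m : ℕ} {A : Multiset ℕ}
    (h : R.val.map f = m ::ₘ A) : ∃ r ∈ R, f r = m ∧ (R.erase r).val.map f = A := by
  simpa [Finset.erase_val] using (Multiset.map_eq_cons f R.val A m).2 h

/-- Two cycles fewer on the same points raise the genus by one. Here the marked cycle grows, in
`merge_other` an unmarked one. -/
theorem Realizable.merge_marked [Fintype α] {s : Finset α} {p q : ℕ} {A B : Multiset ℕ}
    (h : Realizable s p q A (1 ::ₘ 1 ::ₘ B)) : Realizable s p (q + 2) A B := by
  obtain ⟨x, y, t, hw, hx, R, ht, hR, hq, hB⟩ := h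
  obtain ⟨j, hj, hj1, hB⟩ := map_eq_cons hB
  obtain ⟨k, hk, hk1, hB⟩ := map_eq_cons hB
  rw [Finset.mem_erase] at hk
  have htj : j ≠ t := fun e => ht (e ▸ hj)
  have htk : k ≠ t := fun e => ht (e ▸ hk.2)
  obtain ⟨y', h1, h2, h3, h4⟩ := exists_absorb_two hw hR (r := t) (j := j) (k := k) (by simp)
    (by simp [hj]) (by simp [hk.2]) (fixed_of_cycleLength_eq_one hj1)
    (fixed_of_cycleLength_eq_one hk1) htj htk hk.1.symm
  refine ⟨x, y', t, h1, hx, (R.erase j).erase k, by simp [ht], ?_, by rw [h3, hq], ?_⟩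
  · rwa [Finset.erase_insert_of_ne htj.symm, Finset.erase_insert_of_ne htk.symm] at h2
  · rw [← hB]
    refine Multiset.map_congr rfl fun u hu => ?_
    rw [Finset.mem_val, Finset.mem_erase, Finset.mem_erase] at hu
    exact h4 u (by simp [hu.2.2]) (fun e => ht (e ▸ hu.2.2)) hu.2.1 hu.1

theorem Realizable.merge_other [Fintype α] {s : Finset α} {p q m : ℕ} {A B : Multiset ℕ}
    (h : Realizable s p q A (m ::ₘ 1 ::ₘ 1 ::ₘ B)) : Realizable s p q A ((m + 2) ::ₘ B) := by
  obtain ⟨x, y, t, hw, hx, R, ht, hR, hq, hB⟩ := h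
  obtain ⟨r, hr, hrm, hB⟩ := map_eq_cons hB
  obtain ⟨j, hj, hj1, hB⟩ := map_eq_cons hB
  obtain ⟨k, hk, hk1, hB⟩ := map_eq_cons hB
  simp only [Finset.mem_erase] at hj hk
  have htj : j ≠ t := fun e => ht (e ▸ hj.2)
  have htk : k ≠ t := fun e => ht (e ▸ hk.2.2)
  have htr : r ≠ t := fun e => ht (e ▸ hr)
  obtain ⟨y', h1, h2, h3, h4⟩ := exists_absorb_two hw hR (r := r) (j := j) (k := k)
    (by simp [hr]) (by simp [hj.2]) (by simp [hk.2.2]) (fixed_of_cycleLength_eq_one hj1)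
    (fixed_of_cycleLength_eq_one hk1) hj.1 hk.2.1 hk.1.symm
  refine ⟨x, y', t, h1, hx, (R.erase j).erase k, by simp [ht], ?_, ?_, ?_⟩
  · rwa [Finset.erase_insert_of_ne htj.symm, Finset.erase_insert_of_ne htk.symm] at h2
  · rw [h4 t (by simp) htr.symm htj.symm htk.symm, hq]
  · have hr' : r ∈ (R.erase j).erase k := by simp [hr, hj.1.symm, hk.2.1.symm]
    rw [← Finset.insert_erase hr', Finset.insert_val_of_notMem (by simp), Multiset.map_cons, h3,
      hrm, ← hB, Finset.erase_right_comm (s := R.erase j), Finset.erase_right_comm (s := R)]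
    congr 1
    refine Multiset.map_congr rfl fun u hu => ?_
    simp only [Finset.mem_val, Finset.mem_erase] at hu
    exact h4 u (by simp [hu.2.2.2]) hu.2.2.1 hu.2.1 hu.1

/-! ### Realizability in every genus -/

theorem card_le_sum {A : Multiset ℕ} (hA : ∀ m ∈ A, 1 ≤ m) : A.card ≤ A.sum := by
  simpa using Multiset.card_nsmul_le_sum (s := A) (a := 1) hA

theorem two_mul_card_le_sum {A : Multiset ℕ} (hA : ∀ m ∈ A, 1 ≤ m) (h1 : 1 ∉ A) :
    2 * A.card ≤ A.sum := by
  have := Multiset.card_nsmul_le_sum (s := A) (a := 2) fun m hm => by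
    have h := hA m hm
    have : m ≠ 1 := fun e => h1 (e ▸ hm)
    omega
  rw [smul_eq_mul] at this
  omega

theorem realizable_one [Fintype α] {s : Finset α} (hs : s.card = 1) :
    Realizable s 1 1 0 0 := by
  obtain ⟨t, rfl⟩ := Finset.card_eq_one.1 hs
  have : HasCycles (1 : Perm α) {t} t 1 0 :=
    ⟨∅, by simp, ⟨by simp, by simp, by simp, by simp⟩,
      cycleLength_eq_one_of_fixed rfl, by simp⟩
  exact ⟨1, 1, t, ⟨by simp, by simp⟩, this, this⟩

/-- The condition on `p = q = 1` is necessary: a point fixed by `x` and `y` is fixed by the full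
cycle. -/
theorem realizable_of_leaf [Fintype α] {n : ℕ} (hn : 1 ≤ n)
    (ih : ∀ (s : Finset α) (p q : ℕ) (A B : Multiset ℕ), s.card = n → 1 ≤ p → 1 ≤ q →
      (∀ m ∈ A, 1 ≤ m) → (∀ m ∈ B, 1 ≤ m) → p + A.sum = n → q + B.sum = n →
      A.card + B.card + 1 = n → (p = 1 → q = 1 → n = 1) → Realizable s p q A B)
    {s : Finset α} {p q : ℕ} {A B : Multiset ℕ} (hs : s.card = n + 1) (hp : 1 ≤ p) (hq : 2 ≤ q)
    (hA : ∀ m ∈ A, 1 ≤ m) (hB : ∀ m ∈ B, 1 ≤ m) (hpA : p + A.sum = n + 1)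
    (hqB : q + B.sum = n + 1) (hc : A.card + B.card + 1 = n + 1) (h : p = 1 ∨ 1 ∈ A) :
    Realizable s p q A B := by
  obtain ⟨v, s, hv, rfl⟩ : ∃ v s', v ∉ s' ∧ s = insert v s' := by
    obtain ⟨v, hv⟩ := Finset.card_pos.1 (by omega : 0 < s.card)
    exact ⟨v, s.erase v, by simp, (Finset.insert_erase hv).symm⟩
  rw [Finset.card_insert_of_notMem hv] at hs
  obtain ⟨q, rfl⟩ : ∃ q', q = q' + 1 := ⟨q - 1, by omega⟩
  by_cases hp1 : p = 1
  · subst hp1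
    -- A new marked length other than 1 keeps the condition. If there is none, `x` is the identity
    -- and `y` one cycle, so `q = n`.
    obtain ⟨p', hp', hpq⟩ : ∃ p' ∈ A, p' = 1 → q = 1 → n = 1 := by
      by_cases hm : ∃ m ∈ A, m ≠ 1
      · obtain ⟨m, hm, hm1⟩ := hm
        exact ⟨m, hm, fun e => (hm1 e).elim⟩
      · push Not at hm
        have hr : A = Multiset.replicate A.card 1 := Multiset.eq_replicate_card.2 hm
        have hsum : A.sum = A.card := by
          rw [hr]; simp
        obtain ⟨m, hmA⟩ := Multiset.card_pos_iff_exists_mem.1 (by omega : 0 < A.card)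
        have hB0 : B = 0 := Multiset.card_eq_zero.1 (by omega)
        subst hB0
        refine ⟨m, hmA, fun _ h => ?_⟩
        simp at hqB
        omega
    obtain ⟨A, rfl⟩ := Multiset.exists_cons_of_mem hp'
    rw [Multiset.sum_cons] at hpA
    rw [Multiset.card_cons] at hc
    exact (ih s p' q A B (by omega) (hA _ hp') (by omega)
      (fun m hm => hA m (Multiset.mem_cons_of_mem hm)) hB (by omega) (by omega) (by omega)
      hpq).insert_leaf_self hv
  · obtain ⟨A, rfl⟩ := Multiset.exists_cons_of_mem (h.resolve_left hp1)
    rw [Multiset.sum_cons] at hpA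
    rw [Multiset.card_cons] at hc
    exact (ih s p q A B (by omega) hp (by omega)
      (fun m hm => hA m (Multiset.mem_cons_of_mem hm)) hB (by omega) (by omega) (by omega)
      (fun e => (hp1 e).elim)).insert_leaf hv

/-- The genus zero case. -/
theorem realizable_of_card_eq [Fintype α] (n : ℕ) : ∀ (s : Finset α) (p q : ℕ)
    (A B : Multiset ℕ), s.card = n → 1 ≤ p → 1 ≤ q → (∀ m ∈ A, 1 ≤ m) → (∀ m ∈ B, 1 ≤ m) →
      p + A.sum = n → q + B.sum = n → A.card + B.card + 1 = n → (p = 1 → q = 1 → n = 1) →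
      Realizable s p q A B := by
  induction n with
  | zero => intro s p q A B _ hp _ _ _ h; omega
  | succ n ih =>
    intro s p q A B hs hp hq hA hB hpA hqB hc hpq
    have hcA := card_le_sum hA
    have hcB := card_le_sum hB
    rcases Nat.eq_zero_or_pos n with rfl | hn
    · obtain rfl : A = 0 := Multiset.card_eq_zero.1 (by omega)
      obtain rfl : B = 0 := Multiset.card_eq_zero.1 (by omega)
      simp only [Multiset.sum_zero] at hpA hqB
      obtain rfl : p = 1 := by omega
      obtain rfl : q = 1 := by omega
      exact realizable_one hs
    have hleft : (p = 1 ∨ 1 ∈ A) → 2 ≤ q → Realizable s p q A B := fun h hq =>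
      realizable_of_leaf hn ih hs hp hq hA hB hpA hqB hc h
    have hright : (q = 1 ∨ 1 ∈ B) → 2 ≤ p → Realizable s p q A B := fun h hp =>
      (realizable_of_leaf hn ih hs hq hp hB hA hqB hpA (by omega) h).symm
    by_cases hp1 : p = 1
    · exact hleft (Or.inl hp1) (by have := hpq hp1; omega)
    by_cases hq1 : q = 1
    · exact hright (Or.inl hq1) (by omega)
    by_cases hA1 : 1 ∈ A
    · exact hleft (Or.inr hA1) (by omega)
    by_cases hB1 : 1 ∈ B
    · exact hright (Or.inr hB1) (by omega)
    -- If every length is at least 2, there are at most `n + 1` cycles, but the count requires `n +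
    -- 2`.
    have := two_mul_card_le_sum hA hA1
    have := two_mul_card_le_sum hB hB1
    omega

theorem sum_le_two_mul_card {A : Multiset ℕ} (hA : ∀ m ∈ A, m ≤ 2) : A.sum ≤ 2 * A.card := by
  have := Multiset.sum_le_card_nsmul A 2 hA
  rw [smul_eq_mul] at this
  omega

theorem exists_eq_add_two_cons {A : Multiset ℕ} {m : ℕ} (hA : ∀ m ∈ A, 1 ≤ m) (hm : m ∈ A)
    (hm3 : 2 < m) : ∃ m' A', A = (m' + 2) ::ₘ A' ∧
      ∀ l ∈ m' ::ₘ 1 ::ₘ 1 ::ₘ A', 1 ≤ l := by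
  obtain ⟨A, rfl⟩ := Multiset.exists_cons_of_mem hm
  refine ⟨m - 2, A, by rw [Nat.sub_add_cancel hm3.le], ?_⟩
  simp only [Multiset.mem_cons] at hA ⊢
  rintro l (rfl | rfl | rfl | hl)
  · omega
  · rfl
  · rfl
  · exact hA l (Or.inr hl)

theorem realizable [Fintype α] (g : ℕ) : ∀ (s : Finset α) (p q : ℕ)
    (A B : Multiset ℕ), 1 ≤ p → 1 ≤ q → (∀ m ∈ A, 1 ≤ m) → (∀ m ∈ B, 1 ≤ m) →
      p + A.sum = s.card → q + B.sum = s.card → A.card + B.card + 1 + 2 * g = s.card →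
      (p = 1 → q = 1 → s.card = 1) → Realizable s p q A B := by
  induction g with
  | zero => exact fun s p q A B hp hq hA hB hpA hqB hc hpq =>
      realizable_of_card_eq _ s p q A B rfl hp hq hA hB hpA hqB hc hpq
  | succ g ih =>
    intro s p q A B hp hq hA hB hpA hqB hc hpq
    have hcons : ∀ {C : Multiset ℕ}, (∀ m ∈ C, 1 ≤ m) → ∀ m ∈ 1 ::ₘ 1 ::ₘ C, 1 ≤ m := by
      intro C hC m hm
      simp only [Multiset.mem_cons] at hm
      rcases hm with rfl | rfl | hm
      · rfl
      · rfl
      · exact hC m hm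
    by_cases hB3 : ∃ m ∈ B, 2 < m
    · obtain ⟨m, hm, hm3⟩ := hB3
      obtain ⟨m, B, rfl, hB'⟩ := exists_eq_add_two_cons hB hm hm3
      rw [Multiset.sum_cons] at hqB
      rw [Multiset.card_cons] at hc
      exact (ih s p q A _ hp hq hA hB' hpA (by simp only [Multiset.sum_cons]; omega)
        (by simp only [Multiset.card_cons]; omega) hpq).merge_other
    by_cases hA3 : ∃ m ∈ A, 2 < m
    · obtain ⟨m, hm, hm3⟩ := hA3
      obtain ⟨m, A, rfl, hA'⟩ := exists_eq_add_two_cons hA hm hm3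
      rw [Multiset.sum_cons] at hpA
      rw [Multiset.card_cons] at hc
      exact (ih s p q _ B hp hq hA' hB (by simp only [Multiset.sum_cons]; omega) hqB
        (by simp only [Multiset.card_cons]; omega) hpq).symm.merge_other.symm
    -- Lowering `q` by 2 must leave it positive and must not make both marked lengths 1.
    by_cases hq3 : 4 ≤ q ∨ 3 ≤ q ∧ 2 ≤ p
    · obtain ⟨q, rfl⟩ : ∃ q', q = q' + 2 := ⟨q - 2, by omega⟩
      exact (ih s p q A _ hp (by omega) hA (hcons hB) hpA
        (by simp only [Multiset.sum_cons]; omega)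
        (by simp only [Multiset.card_cons]; omega) (by omega)).merge_marked
    by_cases hp3 : 4 ≤ p ∨ 3 ≤ p ∧ 2 ≤ q
    · obtain ⟨p, rfl⟩ : ∃ p', p = p' + 2 := ⟨p - 2, by omega⟩
      exact (ih s p q _ B (by omega) hq (hcons hA) hB
        (by simp only [Multiset.sum_cons]; omega) hqB
        (by simp only [Multiset.card_cons]; omega) (by omega)).symm.merge_marked.symm
    -- With all unmarked lengths at most 2, the count gives `p + q ≥ 6`, which the failed cases
    -- exclude.
    push Not at hA3 hB3
    have := sum_le_two_mul_card hA3
    have := sum_le_two_mul_card hB3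
    omega

/-- There are permutations of `c + 2` points of orders `a`, `b`, `c` and product `1` whose cycles
have these lengths, up to fixed points and at most one transposition. -/
def HasTriple (a b c : ℕ) : Prop :=
  ∃ x y z : Equiv.Perm (Fin (c + 2)),
    orderOf x = a ∧ orderOf y = b ∧ orderOf z = c ∧ x * y * z = 1 ∧
    ∃ k l tx ty tz : ℕ,
      x.cycleType = Multiset.replicate k a + Multiset.replicate tx 2 ∧
      y.cycleType = Multiset.replicate l b + Multiset.replicate ty 2 ∧
      z.cycleType = {c} + Multiset.replicate tz 2 ∧
      tx + ty + tz ≤ 1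

/-! ### From full cycles to triples of given orders -/

theorem HasTriple.symm {a b c : ℕ} (h : HasTriple a b c) : HasTriple b a c := by
  obtain ⟨x, y, z, hx, hy, hz, h1, k, l, tx, ty, tz, cx, cy, cz, ht⟩ := h
  refine ⟨y⁻¹, x⁻¹, z⁻¹, by rwa [orderOf_inv], by rwa [orderOf_inv], by rwa [orderOf_inv], ?_,
    l, k, ty, tx, tz, by rwa [cycleType_inv], by rwa [cycleType_inv], by rwa [cycleType_inv],
    by omega⟩
  rw [← eq_inv_of_mul_eq_one_left h1]
  group

theorem orderOf_eq_of_cycleType {α : Type*} [Fintype α] [DecidableEq α] {σ : Perm α}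
    {k a t : ℕ} (h : σ.cycleType = Multiset.replicate (k + 1) a + Multiset.replicate t 2)
    (ht : t = 0 ∨ 2 ∣ a) : orderOf σ = a := by
  rw [← lcm_cycleType, h]
  apply Nat.dvd_antisymm
  · rw [Multiset.lcm_dvd]
    intro m hm
    rcases Multiset.mem_add.1 hm with hm | hm
    · rw [Multiset.eq_of_mem_replicate hm]
    · rw [Multiset.eq_of_mem_replicate hm]
      rcases ht with rfl | ht
      · simp at hm
      · exact ht
  · exact Multiset.dvd_lcm (by simp)

theorem hasTriple_of_cycleType {a b c k l tx ty tz : ℕ} {x y : Perm (Fin (c + 2))}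
    (hx : x.cycleType = Multiset.replicate (k + 1) a + Multiset.replicate tx 2)
    (hy : y.cycleType = Multiset.replicate (l + 1) b + Multiset.replicate ty 2)
    (hxy : (x * y).cycleType = {c} + Multiset.replicate tz 2)
    (htx : tx = 0 ∨ 2 ∣ a) (hty : ty = 0 ∨ 2 ∣ b) (htz : tz = 0 ∨ 2 ∣ c)
    (ht : tx + ty + tz ≤ 1) : HasTriple a b c := by
  refine ⟨x, y, (x * y)⁻¹, orderOf_eq_of_cycleType hx htx, orderOf_eq_of_cycleType hy hty, ?_,
    mul_inv_cancel _, k + 1, l + 1, tx, ty, tz, hx, hy, by rwa [cycleType_inv], ht⟩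
  rw [orderOf_inv]
  exact orderOf_eq_of_cycleType (k := 0) (by rw [hxy]; rfl) htz

theorem filter_replicate {a : ℕ} (ha : 1 < a) (k r : ℕ) :
    (Multiset.replicate k a + Multiset.replicate r 1).filter (1 < ·) =
      Multiset.replicate k a := by
  rw [Multiset.filter_add, Multiset.filter_eq_self.2, Multiset.filter_eq_nil.2, add_zero]
  · intro m hm
    rw [Multiset.eq_of_mem_replicate hm]
    exact lt_irrefl _
  · intro m hm
    rwa [Multiset.eq_of_mem_replicate hm]

theorem filter_cons_replicate {a : ℕ} (ha : 1 < a) (k r : ℕ) :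
    (a ::ₘ (Multiset.replicate k a + Multiset.replicate r 1)).filter (1 < ·) =
      Multiset.replicate (k + 1) a := by
  rw [Multiset.filter_cons_of_pos _ ha, filter_replicate ha, Multiset.replicate_succ]

theorem one_le_of_mem_replicate {a : ℕ} (ha : 1 < a) (k r : ℕ) :
    ∀ m ∈ Multiset.replicate k a + Multiset.replicate r 1, 1 ≤ m := by
  intro m hm
  rcases Multiset.mem_add.1 hm with hm | hm <;> rw [Multiset.eq_of_mem_replicate hm]
  exact ha.le

theorem exists_realizable {a b c k l r s g p q : ℕ} (ha : 1 < a) (hb : 1 < b) (hp : 1 ≤ p)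
    (hq : 1 ≤ q) (hpa : p + k * a + r = c) (hqb : q + l * b + s = c)
    (hg : k + r + l + s + 1 + 2 * g = c) (hpq : p ≠ 1 ∨ q ≠ 1) :
    ∃ (S : Finset (Fin (c + 2))) (v w : Fin (c + 2)), S.card = c ∧ v ∉ S ∧ w ∉ S ∧ v ≠ w ∧
      Realizable S p q (Multiset.replicate k a + Multiset.replicate r 1)
        (Multiset.replicate l b + Multiset.replicate s 1) := by
  obtain ⟨S, -, hS⟩ := Finset.exists_subset_card_eq
    (s := (Finset.univ : Finset (Fin (c + 2)))) (n := c) (by simp)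
  have hS' : 1 < Sᶜ.card := by rw [Finset.card_compl, hS, Fintype.card_fin]; omega
  obtain ⟨v, hv, w, hw, hvw⟩ := Finset.one_lt_card.1 hS'
  rw [Finset.mem_compl] at hv hw
  refine ⟨S, v, w, hS, hv, hw, hvw, realizable g S p q _ _ hp hq
    (one_le_of_mem_replicate ha k r) (one_le_of_mem_replicate hb l s) ?_ ?_ ?_ (by omega)⟩
  · simp; omega
  · simp; omega
  · simp; omega

/-- The third permutation is a `c`-cycle, the other two move at most the points of this cycle. -/
theorem hasTriple_of_fullCycle {a b c k l r s g : ℕ} (ha : 1 < a) (hb : 1 < b) (hc : 1 < c)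
    (hpa : (k + 1) * a + r = c) (hqb : (l + 1) * b + s = c)
    (hg : k + r + l + s + 1 + 2 * g = c) : HasTriple a b c := by
  obtain ⟨S, -, -, hS, -, -, -, x, y, t, hw, hx, hy⟩ := exists_realizable (p := a) (q := b) ha hb
    ha.le hb.le (by rw [← hpa]; ring) (by rw [← hqb]; ring) hg (by omega)
  have hcyc := hw.isCycle (by omega)
  refine hasTriple_of_cycleType (x := x) (y := y) (k := k) (l := l) (tx := 0) (ty := 0) (tz := 0)
    ?_ ?_ ?_ (by simp) (by simp) (by simp) (by simp)
  · rw [hx.cycleType_eq, filter_cons_replicate ha]; simp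
  · rw [hy.cycleType_eq, filter_cons_replicate hb]; simp
  · rw [hcyc.1.cycleType, hcyc.2, hS]; simp

/-- The third permutation is a `c`-cycle, the first one has an additional transposition. -/
theorem hasTriple_of_fullCycle_insert {a b c k l r s g : ℕ} (ha : 1 < a) (ha2 : 2 ∣ a)
    (hb : 2 < b) (hc : 1 < c) (hpa : 1 + (k + 1) * a + r = c) (hqb : (l + 1) * b + s = c + 1)
    (hg : k + 1 + r + l + s + 1 + 2 * g = c) : HasTriple a b c := by
  have hqb' : b - 1 + l * b + s = c := by
    rw [add_mul, one_mul] at hqb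
    omega
  -- `x` fixes `t`, so `swap t v` becomes its transposition; the cycle of `y` through `t` has room
  -- for `v`.
  obtain ⟨S, v, -, hS, hv, -, -, x, y, t, hw, hx, hy⟩ := exists_realizable (p := 1) (q := b - 1) ha
    (by omega : 1 < b) le_rfl (by omega) hpa hqb' hg (by omega)
  have hcyc := hw.isCycle (by omega)
  -- Inverting twice turns right multiplication by the transposition into left multiplication.
  have hx' := (hx.inv.mul_swap hv).inv
  have hy' := hy.mul_swap hv
  rw [mul_inv_rev, inv_inv, swap_inv] at hx'
  rw [Nat.sub_add_cancel (by omega)] at hy'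
  refine hasTriple_of_cycleType (x := swap t v * x) (y := y * swap t v) (k := k) (l := l)
    (tx := 1) (ty := 0) (tz := 0) ?_ ?_ ?_ (Or.inr ha2) (by simp) (by simp) (by simp)
  · rw [hx'.cycleType_eq, Multiset.filter_cons_of_pos _ (by norm_num), filter_replicate ha,
      add_comm (Multiset.replicate _ _), Multiset.replicate_one, Multiset.singleton_add]
  · rw [hy'.cycleType_eq, filter_cons_replicate (by omega)]; simp
  · have : swap t v * x * (y * swap t v) = swap t v * (x * y) * (swap t v)⁻¹ := by
      rw [swap_inv]; group
    rw [this, cycleType_conj, hcyc.1.cycleType, hcyc.2, hS]; simp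

/-- The third permutation is the product of a `c`-cycle and a transposition. -/
theorem hasTriple_of_fullCycle_mul_swap {a b c k l r s g : ℕ} (ha : 2 < a) (hb : 2 < b)
    (hc : 1 < c) (hc2 : 2 ∣ c) (hpa : (k + 1) * a + r = c + 1) (hqb : (l + 1) * b + s = c + 2)
    (hg : k + r + l + s + 1 + 2 * g = c) : HasTriple a b c := by
  have hpa' : a - 1 + k * a + r = c := by
    rw [add_mul, one_mul] at hpa
    omega
  have hqb' : b - 2 + l * b + s = c := by
    rw [add_mul, one_mul] at hqb
    omega
  -- At `t`, `x` will gain `v`, and `y` both `v` and `w`.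
  obtain ⟨S, v, w, hS, hv, hw, hvw, x, y, t, hxy, hx, hy⟩ := exists_realizable (p := a - 1)
    (q := b - 2) (by omega : 1 < a) (by omega : 1 < b) (by omega) (by omega) hpa' hqb' hg (by omega)
  have hcyc := hxy.isCycle (by omega)
  have htv : t ≠ v := fun e => hv (e ▸ hx.mem)
  have htw : t ≠ w := fun e => hw (e ▸ hx.mem)
  have hx' := (hx.inv.mul_swap hv).inv
  have hy' := (hy.mul_swap hv).mul_swap (v := w) (by simp [hvw.symm, hw])
  rw [mul_inv_rev, inv_inv, swap_inv, Nat.sub_add_cancel (by omega)] at hx'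
  rw [show b - 2 + 1 + 1 = b by omega] at hy'
  refine hasTriple_of_cycleType (x := swap t v * x) (y := y * swap t v * swap t w) (k := k)
    (l := l) (tx := 0) (ty := 0) (tz := 1) ?_ ?_ ?_ (by simp) (by simp) (Or.inr hc2) (by simp)
  · rw [hx'.cycleType_eq, filter_cons_replicate (by omega)]; simp
  · rw [hy'.cycleType_eq, filter_cons_replicate (by omega)]; simp
  -- Conjugation puts `v` in the place of `t` in the full cycle, which makes it disjoint from `swap
  -- t w`.
  · have : swap t v * x * (y * swap t v * swap t w) =
        swap t v * (x * y) * (swap t v)⁻¹ * swap t w := by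
      rw [swap_inv]; group
    have hd : Disjoint (swap t v * (x * y) * (swap t v)⁻¹) (swap t w) := by
      intro u
      by_cases h1 : u = t
      · left
        subst h1
        rw [swap_inv, mul_apply, mul_apply, swap_apply_left, hxy.fixed v hv, swap_apply_right]
      by_cases h2 : u = w
      · left
        subst h2
        rw [swap_inv, mul_apply, mul_apply, swap_apply_of_ne_of_ne h1 hvw.symm, hxy.fixed u hw,
          swap_apply_of_ne_of_ne h1 hvw.symm]
      · exact Or.inr (swap_apply_of_ne_of_ne h1 h2)
    rw [this, hd.cycleType_mul, cycleType_conj, hcyc.1.cycleType, hcyc.2, hS,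
      isSwap_iff_cycleType.1 (swap_isSwap_iff.2 htw)]
    rfl

/-! ### Parity and the numbers of cycles -/

/-- The three involutions of a Klein four-group, which needs all four points. -/
theorem hasTriple_two : HasTriple 2 2 2 := by
  have hd : Disjoint (swap (0 : Fin 4) 1) (swap 2 3) := by
    unfold Perm.Disjoint
    decide
  have h1 : (swap (0 : Fin 4) 1).cycleType = {2} :=
    isSwap_iff_cycleType.1 (swap_isSwap_iff.2 (by decide))
  have h2 : (swap (2 : Fin 4) 3).cycleType = {2} :=
    isSwap_iff_cycleType.1 (swap_isSwap_iff.2 (by decide))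
  refine hasTriple_of_cycleType (x := swap (0 : Fin 4) 1) (y := swap 0 1 * swap 2 3) (k := 0)
    (l := 1) (tx := 0) (ty := 0) (tz := 0) ?_ ?_ ?_ (by simp) (by simp) (by simp) (by simp)
  · rw [h1]; rfl
  · rw [hd.cycleType_mul, h1, h2]; rfl
  · rw [← mul_assoc, swap_mul_self, one_mul, h2]; rfl

/-- Division with remainder, in a form whose products can be treated as atoms. -/
theorem exists_div {a n : ℕ} (ha : 1 < a) (han : a ≤ n) : ∃ k r X : ℕ, (k + 1) * a + r = n ∧
    r < a ∧ X = k * (a - 2) ∧ X + 2 * k + a + r = n := by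
  obtain ⟨k, hk⟩ : ∃ k, n / a = k + 1 :=
    ⟨n / a - 1, by have := Nat.div_pos han (by omega); omega⟩
  have h := Nat.div_add_mod n a
  rw [hk, mul_comm] at h
  obtain ⟨a, rfl⟩ : ∃ a', a = a' + 2 := ⟨a - 2, by omega⟩
  refine ⟨k, n % (a + 2), _, h, Nat.mod_lt _ (by omega), rfl, ?_⟩
  rw [Nat.add_sub_cancel]
  have : (k + 1) * (a + 2) = k * a + 2 * k + (a + 2) := by ring
  omega

theorem even_mul_sub_two {k a : ℕ} (h : a % 2 = 0) : k * (a - 2) % 2 = 0 := by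
  obtain ⟨m, hm⟩ : 2 ∣ a - 2 := by omega
  rw [hm, mul_left_comm, Nat.mul_mod_right]

theorem mul_sub_two_mod_two {k a : ℕ} (ha : 1 < a) (h : a % 2 = 1) :
    k * (a - 2) % 2 = k % 2 := by
  rw [Nat.mul_mod, show (a - 2) % 2 = 1 by omega, mul_one, Nat.mod_mod]

/-- If `a` and `b` are odd and `c` is even, then the third permutation has to be odd. -/
theorem hasTriple_of_odd_of_even {a b c : ℕ} (ha : 2 < a) (hab : a ≤ b) (hbc : b ≤ c)
    (ha2 : a % 2 = 1) (hb2 : b % 2 = 1) (hc2 : c % 2 = 0) : HasTriple a b c := by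
  obtain ⟨k, r, X, h1, hr, hX, h2⟩ := exists_div (a := a) (n := c + 1) (by omega) (by omega)
  obtain ⟨l, s, Y, h3, hs, hY, h4⟩ := exists_div (a := b) (n := c + 2) (by omega) (by omega)
  have hX2 := mul_sub_two_mod_two (k := k) (by omega : 1 < a) ha2
  have hY2 := mul_sub_two_mod_two (k := l) (by omega : 1 < b) hb2
  rw [← hX] at hX2
  rw [← hY] at hY2
  -- `l = 0` and `s = b - 1` would give the odd value `c = 2 * b - 3`.
  have hF2 : 1 ≤ Y + (b - 1 - s) := by
    rcases Nat.eq_zero_or_pos l with rfl | hl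
    · omega
    · have := Nat.mul_le_mul_right (b - 2) hl
      omega
  -- The sum exceeds `2 * (c - k - r - l - s - 1)`, four times the genus, by 3; so the bound says
  -- that the genus is not negative.
  have hF : 3 ≤ (X + (a - 1 - r)) + (Y + (b - 1 - s)) := by
    obtain rfl | rfl | hk : k = 0 ∨ k = 1 ∨ 2 ≤ k := by omega
    · by_cases h0 : r = a - 1
      · rcases Nat.eq_or_lt_of_le hab with rfl | hlt
        · obtain rfl | hl : l = 0 ∨ 1 ≤ l := by omega
          · omega
          · have := Nat.mul_le_mul_right (a - 2) hl
            omega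
        · obtain rfl | hl : l = 0 ∨ 1 ≤ l := by omega
          · omega
          · have := Nat.mul_le_mul_right (b - 2) hl
            omega
      · omega
    · omega
    · have := Nat.mul_le_mul_right (a - 2) hk
      omega
  exact hasTriple_of_fullCycle_mul_swap (g := (c - k - r - l - s - 1) / 2) ha (by omega) (by omega)
    (by omega) h1 h3 (by omega)

theorem hasTriple {a b c : ℕ} (ha : 1 < a) (hab : a ≤ b) (hbc : b ≤ c) : HasTriple a b c := by
  obtain ⟨k, r, X, h1, hr, hX, h2⟩ := exists_div (a := a) (n := c) ha (by omega)
  obtain ⟨l, s, Y, h3, hs, hY, h4⟩ := exists_div (a := b) (n := c) (by omega) hbc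
  have hXe : a % 2 = 0 → X % 2 = 0 := fun h => hX ▸ even_mul_sub_two h
  have hXo : a % 2 = 1 → X % 2 = k % 2 := fun h => hX ▸ mul_sub_two_mod_two ha h
  have hYe : b % 2 = 0 → Y % 2 = 0 := fun h => hY ▸ even_mul_sub_two h
  have hYo : b % 2 = 1 → Y % 2 = l % 2 := fun h => hY ▸ mul_sub_two_mod_two (by omega) h
  -- This count is twice the genus. It is not negative because `r < a` and `s < b`.
  by_cases hG : (c - k - r - l - s - 1) % 2 = 0
  · exact hasTriple_of_fullCycle (g := (c - k - r - l - s - 1) / 2) ha (by omega) (by omega)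
      h1 h3 (by omega)
  -- One of the `r` fixed points of `x` becomes the marked point, while `y` gets one more fixed
  -- point on `c + 1` points.
  by_cases hax : a % 2 = 0 ∧ 1 ≤ r ∧ 3 ≤ b
  · exact hasTriple_of_fullCycle_insert (k := k) (l := l) (r := r - 1) (s := s + 1)
      (g := (c - k - r - l - s - 2) / 2) ha (by omega) (by omega) (by omega) (by omega) (by omega)
      (by omega)
  by_cases hby : b % 2 = 0 ∧ 1 ≤ s ∧ 3 ≤ a
  · exact (hasTriple_of_fullCycle_insert (k := l) (l := k) (r := s - 1) (s := r + 1)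
      (g := (c - k - r - l - s - 2) / 2) (by omega) (by omega) (by omega) (by omega) (by omega)
      (by omega) (by omega)).symm
  rcases Nat.eq_or_lt_of_le ha with rfl | ha3
  · have hX0 : X = 0 := by rw [hX]; simp
    have hY0 : b = 2 → Y = 0 := fun h => by rw [hY, h]; simp
    have hr0 : r = 0 := by omega
    obtain rfl | ⟨k, rfl⟩ : k = 0 ∨ ∃ k', k = k' + 1 := by
      cases k <;> simp
    · obtain rfl : c = 2 := by omega
      obtain rfl : b = 2 := by omega
      exact hasTriple_two
    -- Replacing a 2-cycle of `x` by two fixed points changes the parity.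
    · have h5 : (k + 1) * 2 + 2 = c := by omega
      have h6 : k + 2 + l + s + 1 + 2 * ((c - (k + 1) - r - l - s - 2) / 2) = c := by omega
      exact hasTriple_of_fullCycle ha (by omega) (by omega) h5 h3 h6
  -- An even `a` now has `r = 0`, and an even `b` has `s = 0`, so `c` is even; for odd `a` and `b`
  -- the wrong parity implies it.
  have hc2 : c % 2 = 0 := by omega
  -- Counting the added points as fixed ones lowers the count by 3. If it is only 1, then `a` and
  -- `b` are odd, and `c + 1` and `c + 2` are divided afresh.
  by_cases hG3 : 3 ≤ c - k - r - l - s - 1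
  · exact hasTriple_of_fullCycle_mul_swap (k := k) (l := l) (r := r + 1) (s := s + 2)
      (g := (c - k - r - l - s - 4) / 2) ha3 (by omega) (by omega) (by omega) (by omega)
      (by omega) (by omega)
  · exact hasTriple_of_odd_of_even ha3 hab hbc (by omega) (by omega) hc2

end CycleTriple

theorem mainTheorem1 (a b c : ℕ) (ha : 1 < a) (hab : a ≤ b) (hbc : b ≤ c) :
    ∃ x y z : Equiv.Perm (Fin (c + 2)),
      orderOf x = a ∧ orderOf y = b ∧ orderOf z = c ∧ x * y * z = 1 ∧
      ∃ k l tx ty tz : ℕ,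
        x.cycleType = Multiset.replicate k a + Multiset.replicate tx 2 ∧
        y.cycleType = Multiset.replicate l b + Multiset.replicate ty 2 ∧
        z.cycleType = {c} + Multiset.replicate tz 2 ∧
        tx + ty + tz ≤ 1 :=
  CycleTriple.hasTriple ha hab hbc
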